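/- Let $n\ge 2$ and let $B_{n,n-1}(X)=\prod_{S\subseteq\{1,\dots,n\},\,|S|=n-1}\ \sum_{i\in S}x_i\in\mathbb{C}[x_1,\dots,x_n]$ be the $(n,n-1)$-th Boolean product polynomial in the alphabet $X=\{x_1,\dots,x_n\}$. Then $$B_{n,n-1}(X)=\sum_{\lambda\vdash n}a_\lambda\, s_\lambda(X),$$ where $s_\lambda(X)=s_\lambda(x_1,\dots,x_n)$ is the Schur polynomial and $a_\lambda$ is the number of standard Young tableaux of shape $\lambda$ whose smallest ascent is even; in particular $B_{n,n-1}(X)$ is Schur-positive. Here Young diagrams are drawn in French notation (row $i$ from the bottom has $\lambda_i$ boxes, and entries increase from left to right and from bottom to top). An entry $i$ of a standard Young tableau is a descent if $i+1$ occurs in a row strictly above that of $i$, and an ascent otherwise; in particular, the largest entry $n$ is always an ascent. -/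

import Mathlib

namespace BooleanProduct

open MvPolynomial

/-- The Boolean product polynomial `B_{n,k}(X) = ∏_{S ⊆ [n], |S| = k} ∑_{i ∈ S} x_i` in
`ℂ[x_1, …, x_n]`. The variable `x_{i+1}` is `X i` for `i : Fin n`. -/
noncomputable def booleanProduct (n k : ℕ) : MvPolynomial (Fin n) ℂ :=
  ∏ S ∈ Finset.powersetCard k (Finset.univ : Finset (Fin n)), ∑ i ∈ S, X i

/-- Partitions `λ ⊢ n`, given by their Young diagrams: the cell `(i, j)` lies in the
`(i+1)`-st row and the `(j+1)`-st column, and row `i+1` has `λ_{i+1}` cells. -/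
abbrev Shape (n : ℕ) : Type := {μ : YoungDiagram // μ.card = n}

theorem lt_card_of_mem {μ : YoungDiagram} {i j : ℕ} (h : (i, j) ∈ μ) :
    i < μ.card ∧ j < μ.card := by
  have hsub : Finset.range (i + 1) ×ˢ Finset.range (j + 1) ⊆ μ.cells := by
    intro c hc
    obtain ⟨a, b⟩ := c
    simp only [Finset.mem_product, Finset.mem_range] at hc
    exact μ.up_left_mem (by omega) (by omega) h
  have hcard := Finset.card_le_card hsub
  rw [Finset.card_product, Finset.card_range, Finset.card_range] at hcard
  change _ ≤ μ.card at hcard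
  constructor <;> nlinarith

instance shapeFinite (n : ℕ) : Finite (Shape n) := by
  let B : Finset (Finset (ℕ × ℕ)) := (Finset.range n ×ˢ Finset.range n).powerset
  refine Finite.of_injective
    (fun μ : Shape n => (⟨μ.1.cells, ?_⟩ : {s : Finset (ℕ × ℕ) // s ∈ B})) ?_
  · rw [Finset.mem_powerset]
    rintro ⟨i, j⟩ hc
    have h := lt_card_of_mem (μ := μ.1) hc
    rw [μ.2] at h
    simpa using h
  · intro μ ν h
    exact Subtype.ext (YoungDiagram.ext (congrArg Subtype.val h))

noncomputable instance shapeFintype (n : ℕ) : Fintype (Shape n) := Fintype.ofFinite _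

/-- `SSYT(μ, m)`: the semistandard Young tableaux of shape `μ` with entries in `{1, …, m}`. -/
abbrev SSYT (μ : YoungDiagram) (m : ℕ) : Type :=
  {T : SemistandardYoungTableau μ // ∀ i j, (i, j) ∈ μ → 1 ≤ T i j ∧ T i j ≤ m}

instance ssytFinite (μ : YoungDiagram) (m : ℕ) : Finite (SSYT μ m) := by
  refine Finite.of_injective
    (fun T : SSYT μ m => fun c : μ.cells =>
      (⟨T.1 c.1.1 c.1.2, Nat.lt_succ_of_le (T.2 _ _ c.2).2⟩ : Fin (m + 1))) ?_
  intro T U h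
  apply Subtype.ext
  ext i j
  by_cases hc : (i, j) ∈ μ
  · exact congrArg Fin.val (congrFun h ⟨(i, j), hc⟩)
  · rw [T.1.zeros hc, U.1.zeros hc]

noncomputable instance ssytFintype (μ : YoungDiagram) (m : ℕ) : Fintype (SSYT μ m) :=
  Fintype.ofFinite _

/-- The number of cells of `T` with entry `k`. -/
def content {μ : YoungDiagram} (T : SemistandardYoungTableau μ) (k : ℕ) : ℕ :=
  (μ.cells.filter fun c => T c.1 c.2 = k).card

/-- The Schur polynomial `s_μ(x_1, …, x_n) = ∑_{T ∈ SSYT(μ, n)} ∏_i x_i ^ (number of i's in T)`. -/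
noncomputable def schur (μ : YoungDiagram) (n : ℕ) : MvPolynomial (Fin n) ℂ :=
  ∑ T : SSYT μ n, ∏ i : Fin n, X i ^ content T.1 (i + 1)

/-- `SYT(μ)`: semistandard tableaux of shape `μ` with distinct entries from `{1, …, |μ|}`. -/
abbrev SYT (μ : YoungDiagram) : Type :=
  {T : SSYT μ μ.card // Set.InjOn (fun c : ℕ × ℕ => T.1 c.1 c.2) (μ.cells : Set (ℕ × ℕ))}

/-- `k` is a descent of `T` if `k + 1` lies in a row strictly above that of `k`, where the rows
are drawn from bottom to top: the row of `k + 1` has the larger index. -/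
def IsDescent {μ : YoungDiagram} (T : SYT μ) (k : ℕ) : Prop :=
  ∃ i j i' j', (i, j) ∈ μ ∧ (i', j') ∈ μ ∧
    T.1.1 i j = k ∧ T.1.1 i' j' = k + 1 ∧ i < i'

/-- An entry of `T` that is not a descent is an ascent; the largest entry is an ascent. -/
def IsAscent {μ : YoungDiagram} (T : SYT μ) (k : ℕ) : Prop :=
  (∃ i j, (i, j) ∈ μ ∧ T.1.1 i j = k) ∧ ¬ IsDescent T k

/-- The number `a_μ` of standard Young tableaux of shape `μ` whose smallest ascent is even. -/
noncomputable def evenAscentCount (μ : YoungDiagram) : ℕ :=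
  Nat.card {T : SYT μ // ∃ k, IsLeast {k | IsAscent T k} k ∧ Even k}

end BooleanProduct

/-!
The sums of all variables but one are `t - x_i` with `t = x_1 + ⋯ + x_n`, so the Boolean product
polynomial is `∏ (t - x_i) = ∑_k (-1)^k e_k t^(n-k)` (`booleanProduct_pred`,
`sum_schurEval_column`). The elementary symmetric polynomial `e_k` enters as the
Schur polynomial of a column of `k` cells. Multiplication by `t` adds a cell in all possible ways
(`sum_mul_schurEval`, Pieri's rule). Hence the coefficient of `s_μ` in `e_k t^(n-k)` is the number
of ways to grow `μ` from a column of `k` cells one cell at a time, which is the number of standard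
tableaux of shape `μ` whose entries `1, …, k` lie in the first column
(`schurEval_column_mul_pow`). These are the tableaux whose smallest ascent `a` is at least `k`
(`isColumnStart_iff_le`), so a tableau contributes `∑_{k ≤ a} (-1)^k` in total, which is `1` if `a`
is even and `0` otherwise (`sum_columnStartCount`).

Both Pieri's rule and the recursion for standard tableaux rest on the bijection
`extend_bijective`: a tableau with entries up to `m + 1` is a tableau with entries up to `m`
together with a horizontal strip of cells filled with `m + 1`. Pieri's rule then follows by
induction on the number of variables from a statement on diagrams alone, that adding a cell
commutes with removing a horizontal strip up to one extra term (`ncard_covers_isStrip`).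
-/

namespace BooleanProduct

/-! ### Horizontal strips and covers of Young diagrams -/

/-- `μ / κ` is a horizontal strip: no two of its cells lie in the same column. -/
def IsStrip (κ μ : YoungDiagram) : Prop :=
  κ ≤ μ ∧ ∀ i j, (i + 1, j) ∈ μ → (i, j) ∈ κ

/-- `ν` is `μ` together with one more cell. -/
def Covers (μ ν : YoungDiagram) : Prop :=
  μ ≤ ν ∧ ν.card = μ.card + 1

/-- `ν` is `μ` together with one more cell, which lies in row `i`. -/
def AddsAt (i : ℕ) (μ ν : YoungDiagram) : Prop :=
  ∀ j, ν.rowLen j = μ.rowLen j + if j = i then 1 else 0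

theorem le_iff_rowLen {κ μ : YoungDiagram} : κ ≤ μ ↔ ∀ i, κ.rowLen i ≤ μ.rowLen i := by
  constructor
  · intro h i
    by_contra! hlt
    exact lt_irrefl _ (YoungDiagram.mem_iff_lt_rowLen.1
      (h (YoungDiagram.mem_iff_lt_rowLen.2 hlt)))
  · rintro h ⟨i, j⟩ hc
    exact YoungDiagram.mem_iff_lt_rowLen.2 ((YoungDiagram.mem_iff_lt_rowLen.1 hc).trans_le (h i))

theorem ext_rowLen {κ μ : YoungDiagram} (h : ∀ i, κ.rowLen i = μ.rowLen i) : κ = μ :=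
  le_antisymm (le_iff_rowLen.2 fun i => (h i).le) (le_iff_rowLen.2 fun i => (h i).ge)

theorem isStrip_iff_rowLen {κ μ : YoungDiagram} :
    IsStrip κ μ ↔ ∀ i, κ.rowLen i ≤ μ.rowLen i ∧ μ.rowLen (i + 1) ≤ κ.rowLen i := by
  rw [IsStrip, le_iff_rowLen, forall_and]
  refine and_congr_right fun _ => forall_congr' fun i => ?_
  simp only [YoungDiagram.mem_iff_lt_rowLen]
  refine ⟨fun h => ?_, fun h j hj => hj.trans_le h⟩
  by_contra! hlt
  exact lt_irrefl _ (h _ hlt)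

theorem exists_rowLen_eq {f : ℕ → ℕ} (hf : Antitone f) {N : ℕ} (hN : f N = 0) :
    ∃ μ : YoungDiagram, ∀ i, μ.rowLen i = f i := by
  have hmem : ∀ i j, (i, j) ∈ (Finset.range N ×ˢ Finset.range (f 0)).filter
      (fun c : ℕ × ℕ => c.2 < f c.1) ↔ j < f i := by
    intro i j
    simp only [Finset.mem_filter, Finset.mem_product, Finset.mem_range]
    refine ⟨fun h => h.2, fun h => ⟨⟨?_, h.trans_le (hf (Nat.zero_le i))⟩, h⟩⟩
    by_contra! hi
    have := hf hi
    omega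
  refine ⟨⟨(Finset.range N ×ˢ Finset.range (f 0)).filter (fun c : ℕ × ℕ => c.2 < f c.1), ?_⟩,
    fun i => ?_⟩
  · rintro ⟨a, b⟩ ⟨a', b'⟩ hle hc
    have hle' := Prod.mk_le_mk.1 hle
    rw [Finset.mem_coe, hmem] at hc ⊢
    have := hf hle'.1
    omega
  · refine eq_of_forall_lt_iff fun j => ?_
    rw [← YoungDiagram.mem_iff_lt_rowLen]
    exact hmem i j

theorem covers_iff_exists_addsAt {μ ν : YoungDiagram} :
    Covers μ ν ↔ ∃ i, AddsAt i μ ν := by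
  constructor
  · rintro ⟨hle, hcard⟩
    have hsub : μ.cells ⊆ ν.cells := hle
    have h1 : (ν.cells \ μ.cells).card = 1 := by
      rw [Finset.card_sdiff_of_subset hsub]
      exact Nat.sub_eq_of_eq_add' hcard
    obtain ⟨⟨i, b⟩, hib⟩ := Finset.card_eq_one.1 h1
    have hmem : ∀ j y, y < ν.rowLen j ↔ y < μ.rowLen j ∨ (j = i ∧ y = b) := by
      intro j y
      have := Finset.ext_iff.1 hib (j, y)
      simp only [Finset.mem_sdiff, YoungDiagram.mem_cells, Finset.mem_singleton,
        Prod.mk.injEq, YoungDiagram.mem_iff_lt_rowLen] at this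
      have h2 : y < μ.rowLen j → y < ν.rowLen j := fun h =>
        h.trans_le (le_iff_rowLen.1 hle j)
      tauto
    have hb : ¬ b < μ.rowLen i := by
      have := Finset.ext_iff.1 hib (i, b)
      simp only [Finset.mem_sdiff, YoungDiagram.mem_cells, Finset.mem_singleton,
        YoungDiagram.mem_iff_lt_rowLen] at this
      tauto
    refine ⟨i, fun j => ?_⟩
    split_ifs with hj
    · subst hj
      have e1 := hmem j b
      have e2 := hmem j (μ.rowLen j)
      have e3 := hmem j (μ.rowLen j + 1)
      omega
    · refine eq_of_forall_lt_iff fun y => ?_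
      rw [hmem]
      simp [hj]
  · rintro ⟨i, h⟩
    have hnot : (i, μ.rowLen i) ∉ μ.cells := by
      simp [YoungDiagram.mem_iff_lt_rowLen]
    have hcells : ν.cells = insert (i, μ.rowLen i) μ.cells := by
      ext ⟨a, b⟩
      rw [Finset.mem_insert, YoungDiagram.mem_cells, YoungDiagram.mem_cells,
        YoungDiagram.mem_iff_lt_rowLen, YoungDiagram.mem_iff_lt_rowLen, h a, Prod.mk.injEq]
      by_cases ha : a = i
      · subst ha
        simp only [if_true, true_and]
        omega
      · simp [ha]
    refine ⟨le_iff_rowLen.2 fun j => by rw [h j]; omega, ?_⟩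
    rw [YoungDiagram.card, hcells, Finset.card_insert_of_notMem hnot]

theorem AddsAt.unique_row {i i' : ℕ} {μ ν : YoungDiagram} (h : AddsAt i μ ν)
    (h' : AddsAt i' μ ν) : i = i' := by
  have h1 := h i
  have h2 := h' i
  by_contra hne
  rw [if_pos rfl] at h1
  rw [if_neg hne] at h2
  omega

/-- If `R` relates indices to elements one-to-one, then its domain and its range have the same
size. -/
theorem ncard_eq_of_relation {α β : Type*} {R : α → β → Prop}
    (hl : ∀ a a' b, R a b → R a' b → a = a') (hr : ∀ a b b', R a b → R a b' → b = b') :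
    {b | ∃ a, R a b}.ncard = {a | ∃ b, R a b}.ncard := by
  refine Set.ncard_congr (fun b hb => Classical.choose hb) ?_ ?_ ?_
  · exact fun b hb => ⟨b, Classical.choose_spec hb⟩
  · intro b b' hb hb' heq
    have h1 := Classical.choose_spec hb
    have h2 := Classical.choose_spec hb'
    rw [← heq] at h2
    exact hr _ _ _ h1 h2
  · rintro a ⟨b, hab⟩
    exact ⟨b, ⟨a, hab⟩, hl _ _ _ (Classical.choose_spec (⟨a, hab⟩ : ∃ a, R a b)) hab⟩

/-- The row lengths of `μ` and `ρ` decide whether adding a cell to `μ` in row `i` yields a diagram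
that exceeds `ρ` by a horizontal strip. -/
theorem exists_addsAt_isStrip_iff {i : ℕ} {μ ρ : YoungDiagram} :
    (∃ ν, AddsAt i μ ν ∧ IsStrip ρ ν) ↔
      (∀ j, j + 1 = i → μ.rowLen i + 1 ≤ μ.rowLen j) ∧
      ∀ j, ρ.rowLen j ≤ μ.rowLen j + (if j = i then 1 else 0) ∧
        μ.rowLen (j + 1) + (if j + 1 = i then 1 else 0) ≤ ρ.rowLen j := by
  constructor
  · rintro ⟨ν, hν, hs⟩
    rw [isStrip_iff_rowLen] at hs
    refine ⟨fun j hj => ?_, fun j => ?_⟩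
    · have h1 := hν i
      have h2 := hν j
      have h3 := ν.rowLen_anti j i (by omega)
      rw [if_pos rfl] at h1
      rw [if_neg (by omega)] at h2
      omega
    · rw [← hν, ← hν]
      exact hs j
  · rintro ⟨h1, h2⟩
    have hanti : Antitone fun j => μ.rowLen j + if j = i then 1 else 0 := by
      refine antitone_nat_of_succ_le fun j => ?_
      have h3 := μ.rowLen_anti j (j + 1) (by omega)
      by_cases hj : j + 1 = i
      · subst hj
        have := h1 j rfl
        simpa using this
      · simp only [hj, if_false]
        omega
    have hzero : (fun j => μ.rowLen j + if j = i then 1 else 0) (μ.card + i + 1) = 0 := by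
      have hnot : (μ.card + i + 1, 0) ∉ μ := fun h => by
        have := (lt_card_of_mem h).1
        omega
      rw [YoungDiagram.mem_iff_lt_rowLen] at hnot
      simp only
      rw [if_neg (by omega)]
      omega
    obtain ⟨ν, hν⟩ := exists_rowLen_eq hanti hzero
    refine ⟨ν, hν, isStrip_iff_rowLen.2 fun j => ?_⟩
    rw [hν, hν]
    exact h2 j

/-- The row lengths of `μ` and `ρ` decide whether removing a cell from `ρ` in row `i` yields a
diagram that `μ` exceeds by a horizontal strip. -/
theorem exists_addsAt_isStrip_left_iff {i : ℕ} {μ ρ : YoungDiagram} :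
    (∃ κ, AddsAt i κ ρ ∧ IsStrip κ μ) ↔
      ρ.rowLen (i + 1) + 1 ≤ ρ.rowLen i ∧
      ∀ j, ρ.rowLen j ≤ μ.rowLen j + (if j = i then 1 else 0) ∧
        μ.rowLen (j + 1) + (if j = i then 1 else 0) ≤ ρ.rowLen j := by
  constructor
  · rintro ⟨κ, hκ, hs⟩
    rw [isStrip_iff_rowLen] at hs
    refine ⟨?_, fun j => ?_⟩
    · have h1 := hκ i
      have h2 := hκ (i + 1)
      have h3 := κ.rowLen_anti i (i + 1) (by omega)
      rw [if_pos rfl] at h1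
      rw [if_neg (by omega)] at h2
      omega
    · have := hs j
      rw [hκ]
      omega
  · rintro ⟨h1, h2⟩
    have hanti : Antitone fun j => ρ.rowLen j - if j = i then 1 else 0 := by
      refine antitone_nat_of_succ_le fun j => ?_
      have h3 := ρ.rowLen_anti j (j + 1) (by omega)
      by_cases hj : j = i
      · subst hj
        simp only [if_true]
        split_ifs <;> omega
      · simp only [hj, if_false]
        omega
    have hzero : (fun j => ρ.rowLen j - if j = i then 1 else 0) ρ.card = 0 := by
      have hnot : (ρ.card, 0) ∉ ρ := fun h => lt_irrefl _ (lt_card_of_mem h).1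
      rw [YoungDiagram.mem_iff_lt_rowLen] at hnot
      simp only
      omega
    obtain ⟨κ, hκ⟩ := exists_rowLen_eq hanti hzero
    refine ⟨κ, fun j => ?_, isStrip_iff_rowLen.2 fun j => ?_⟩
    · rw [hκ]
      split_ifs with hj
      · subst hj; omega
      · omega
    · rw [hκ]
      have := h2 j
      omega

/-- The commutation relation between adding a cell and removing a horizontal strip. When `μ / ρ`
is a horizontal strip, a cell can be added to `μ` in row `i + 1` so that the difference with `ρ`
remains a strip precisely when one can be so removed from `ρ` in row `i`, and a cell can always be
added in row `0`. Otherwise, if either count is nonzero, `ρ` is longer than `μ` in a single row, and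
both counts concern the cell in that row. -/
theorem ncard_covers_isStrip (μ ρ : YoungDiagram) [Decidable (IsStrip ρ μ)] :
    {ν | Covers μ ν ∧ IsStrip ρ ν}.ncard =
      {κ | Covers κ ρ ∧ IsStrip κ μ}.ncard + if IsStrip ρ μ then 1 else 0 := by
  have hup : {ν | Covers μ ν ∧ IsStrip ρ ν}.ncard =
      {i | ∃ ν, AddsAt i μ ν ∧ IsStrip ρ ν}.ncard := by
    rw [← ncard_eq_of_relation]
    · simp only [covers_iff_exists_addsAt, exists_and_right]
    · exact fun i i' ν h h' => h.1.unique_row h'.1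
    · exact fun i ν ν' h h' => ext_rowLen fun j => by rw [h.1 j, h'.1 j]
  have hdown : {κ | Covers κ ρ ∧ IsStrip κ μ}.ncard =
      {i | ∃ κ, AddsAt i κ ρ ∧ IsStrip κ μ}.ncard := by
    rw [← ncard_eq_of_relation]
    · simp only [covers_iff_exists_addsAt, exists_and_right]
    · exact fun i i' ν h h' => h.1.unique_row h'.1
    · intro i κ κ' h h'
      refine ext_rowLen fun j => ?_
      have := h.1 j
      have := h'.1 j
      omega
  rw [hup, hdown]
  simp only [exists_addsAt_isStrip_iff, exists_addsAt_isStrip_left_iff]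
  split_ifs with hs
  · rw [isStrip_iff_rowLen] at hs
    set B := {i | ρ.rowLen (i + 1) + 1 ≤ ρ.rowLen i ∧
      ∀ j, ρ.rowLen j ≤ μ.rowLen j + (if j = i then 1 else 0) ∧
        μ.rowLen (j + 1) + (if j = i then 1 else 0) ≤ ρ.rowLen j} with hB
    have hfin : B.Finite := by
      refine (Set.finite_Iio ρ.card).subset fun i hi => ?_
      refine (lt_card_of_mem (μ := ρ) (i := i) (j := 0) ?_).1
      rw [YoungDiagram.mem_iff_lt_rowLen]
      have := hi.1
      omega
    have hset : {i | (∀ j, j + 1 = i → μ.rowLen i + 1 ≤ μ.rowLen j) ∧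
      ∀ j, ρ.rowLen j ≤ μ.rowLen j + (if j = i then 1 else 0) ∧
        μ.rowLen (j + 1) + (if j + 1 = i then 1 else 0) ≤ ρ.rowLen j} =
        insert 0 (Nat.succ '' B) := by
      ext i
      rcases i with _ | i
      · simp only [Set.mem_ofPred_eq, Set.mem_insert_iff, true_or, iff_true]
        refine ⟨fun j hj => by omega, fun j => ?_⟩
        have := hs j
        rw [if_neg (Nat.succ_ne_zero j)]
        omega
      · simp only [Set.mem_ofPred_eq, Set.mem_insert_iff, Nat.succ_ne_zero, false_or,
          Set.mem_image, Nat.succ.injEq, exists_eq_right, hB]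
        constructor
        · rintro ⟨h1, h2⟩
          refine ⟨?_, fun j => ?_⟩
          · have e1 := (h2 i).2
            have e2 := (hs (i + 1)).1
            rw [if_pos rfl] at e1
            omega
          · have := h2 j
            have := hs j
            omega
        · rintro ⟨h1, h2⟩
          refine ⟨fun j hj => ?_, fun j => ?_⟩
          · subst hj
            have e1 := (h2 j).2
            have e2 := (hs j).1
            rw [if_pos rfl] at e1
            omega
          · have := h2 j
            have := hs j
            omega
    rw [hset, Set.ncard_insert_of_notMem (by simp) (hfin.image _),
      Set.ncard_image_of_injective _ Nat.succ_injective]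
  · rw [isStrip_iff_rowLen] at hs
    push Not at hs
    obtain ⟨r, hr⟩ := hs
    rw [add_zero]
    congr 1
    ext i
    simp only [Set.mem_ofPred_eq]
    -- Row `i` is the only row in which `ρ` is longer than `μ`, and it is longer by one.
    constructor
    · rintro ⟨h1, h2⟩
      have hri : ρ.rowLen i = μ.rowLen i + 1 := by
        have e1 := h2 r
        have e2 := (h2 i).1
        have e3 : r = i := by
          by_contra hne
          rw [if_neg hne] at e1
          have := hr (by omega)
          omega
        subst e3
        by_contra hne
        rw [if_pos rfl] at e2
        have := hr (by omega)
        omega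
      refine ⟨?_, fun j => ⟨(h2 j).1, ?_⟩⟩
      · have e1 := (h2 (i + 1)).1
        have := μ.rowLen_anti i (i + 1) (by omega)
        rw [if_neg (by omega)] at e1
        omega
      · have := h2 j
        have := μ.rowLen_anti j (j + 1) (by omega)
        split_ifs with hj
        · subst hj
          omega
        · omega
    · rintro ⟨h1, h2⟩
      have hri : ρ.rowLen i = μ.rowLen i + 1 := by
        have e1 := h2 r
        have e2 := (h2 i).1
        have e3 : r = i := by
          by_contra hne
          rw [if_neg hne] at e1
          have := hr (by omega)
          omega
        subst e3
        by_contra hne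
        rw [if_pos rfl] at e2
        have := hr (by omega)
        omega
      refine ⟨fun j hj => ?_, fun j => ⟨(h2 j).1, ?_⟩⟩
      · subst hj
        have e1 := (h2 j).1
        have := ρ.rowLen_anti j (j + 1) (by omega)
        rw [if_neg (by omega)] at e1
        omega
      · have := h2 j
        have := ρ.rowLen_anti j (j + 1) (by omega)
        split_ifs with hj
        · subst hj
          omega
        · omega

/-! ### The branching rule for semistandard tableaux -/

/-- The tableau of shape `μ` that agrees with `T` on `κ` and has the entry `m + 1` on the
horizontal strip `μ / κ`. -/
noncomputable def extend {κ μ : YoungDiagram} (h : IsStrip κ μ) {m : ℕ} (T : SSYT κ m) :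
    SSYT μ (m + 1) where
  val :=
    { entry := fun i j => if (i, j) ∈ κ then T.1 i j else if (i, j) ∈ μ then m + 1 else 0
      row_weak' := by
        intro i j1 j2 hj hc
        by_cases h2 : (i, j2) ∈ κ
        · have h1 := κ.up_left_mem le_rfl hj.le h2
          rw [if_pos h1, if_pos h2]
          exact T.1.row_weak hj h2
        · rw [if_neg h2, if_pos hc]
          split_ifs with h1
          · exact (T.2 _ _ h1).2.trans (Nat.le_succ m)
          · exact le_rfl
          · exact Nat.zero_le _
      col_strict' := by
        intro i1 i2 j hi hc
        obtain ⟨i, rfl⟩ : ∃ i, i2 = i + 1 := ⟨i2 - 1, by omega⟩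
        have h1 : (i1, j) ∈ κ := κ.up_left_mem (Nat.lt_succ_iff.1 hi) le_rfl (h.2 i j hc)
        rw [if_pos h1]
        split_ifs with h2
        · exact T.1.col_strict hi h2
        · exact Nat.lt_succ_of_le (T.2 _ _ h1).2
      zeros' := by
        intro i j hc
        rw [if_neg fun hk => hc (h.1 hk), if_neg hc] }
  property := by
    intro i j hc
    change 1 ≤ (if (i, j) ∈ κ then T.1 i j else if (i, j) ∈ μ then m + 1 else 0) ∧
      (if (i, j) ∈ κ then T.1 i j else if (i, j) ∈ μ then m + 1 else 0) ≤ m + 1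
    split_ifs with h1
    · exact ⟨(T.2 _ _ h1).1, (T.2 _ _ h1).2.trans (Nat.le_succ m)⟩
    · exact ⟨Nat.succ_le_succ (Nat.zero_le m), le_rfl⟩

theorem extend_of_mem {κ μ : YoungDiagram} (h : IsStrip κ μ) {m : ℕ} (T : SSYT κ m) {i j : ℕ}
    (hc : (i, j) ∈ κ) : (extend h T).1 i j = T.1 i j :=
  if_pos hc

theorem extend_of_notMem {κ μ : YoungDiagram} (h : IsStrip κ μ) {m : ℕ} (T : SSYT κ m) {i j : ℕ}
    (hc : (i, j) ∉ κ) (hc' : (i, j) ∈ μ) : (extend h T).1 i j = m + 1 :=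
  (if_neg hc).trans (if_pos hc')

theorem mem_iff_extend_le {κ μ : YoungDiagram} (h : IsStrip κ μ) {m : ℕ} (T : SSYT κ m)
    {i j : ℕ} (hc : (i, j) ∈ μ) : (i, j) ∈ κ ↔ (extend h T).1 i j ≤ m := by
  by_cases hk : (i, j) ∈ κ
  · simp only [hk, extend_of_mem h T hk, (T.2 _ _ hk).2]
  · simp [hk, extend_of_notMem h T hk hc]

/-- Every tableau with entries up to `m + 1` arises by `extend` in exactly one way: its entries up
to `m` form the smaller tableau. -/
theorem extend_bijective (μ : YoungDiagram) (m : ℕ) :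
    Function.Bijective fun p : (Σ κ : {κ // IsStrip κ μ}, SSYT κ.1 m) => extend p.1.2 p.2 := by
  constructor
  · rintro ⟨⟨κ, hκ⟩, T⟩ ⟨⟨κ', hκ'⟩, T'⟩ heq
    simp only at heq
    obtain rfl : κ = κ' := by
      refine YoungDiagram.ext (Finset.ext ?_)
      rintro ⟨i, j⟩
      simp only [YoungDiagram.mem_cells]
      by_cases hc : (i, j) ∈ μ
      · rw [mem_iff_extend_le hκ T hc, mem_iff_extend_le hκ' T' hc, heq]
      · exact iff_of_false (fun h => hc (hκ.1 h)) fun h => hc (hκ'.1 h)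
    obtain rfl : T = T' := by
      apply Subtype.ext
      ext i j
      by_cases hc : (i, j) ∈ κ
      · rw [← extend_of_mem hκ T hc, heq, extend_of_mem hκ' T' hc]
      · rw [T.1.zeros hc, T'.1.zeros hc]
    rfl
  · intro U
    let κ : YoungDiagram :=
      { cells := μ.cells.filter fun c => U.1 c.1 c.2 ≤ m
        isLowerSet := by
          rintro ⟨a, b⟩ ⟨a', b'⟩ hle hc
          have hle' := Prod.mk_le_mk.1 hle
          simp only [Finset.coe_filter, YoungDiagram.mem_cells, Set.mem_ofPred_eq] at hc ⊢
          have h1 : (a', b) ∈ μ := μ.up_left_mem hle'.1 le_rfl hc.1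
          exact ⟨μ.up_left_mem le_rfl hle'.2 h1, (U.1.row_weak_of_le hle'.2 h1).trans
            ((U.1.col_weak hle'.1 hc.1).trans hc.2)⟩ }
    have hκ : ∀ i j, (i, j) ∈ κ ↔ (i, j) ∈ μ ∧ U.1 i j ≤ m := fun i j =>
      Finset.mem_filter (s := μ.cells) (p := fun c => U.1 c.1 c.2 ≤ m)
    have hs : IsStrip κ μ := by
      refine ⟨?_, fun i j hc => ?_⟩
      · rintro ⟨i, j⟩ hc
        exact ((hκ i j).1 hc).1
      · refine (hκ i j).2 ⟨μ.up_left_mem (Nat.le_succ i) le_rfl hc, ?_⟩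
        have h1 := U.1.col_strict (Nat.lt_add_one i) hc
        have h2 := (U.2 _ _ hc).2
        omega
    let T : SSYT κ m :=
      { val :=
          { entry := fun i j => if (i, j) ∈ κ then U.1 i j else 0
            row_weak' := by
              intro i j1 j2 hj hc
              rw [if_pos hc, if_pos (κ.up_left_mem le_rfl hj.le hc)]
              exact U.1.row_weak hj ((hκ _ _).1 hc).1
            col_strict' := by
              intro i1 i2 j hi hc
              rw [if_pos hc, if_pos (κ.up_left_mem hi.le le_rfl hc)]
              exact U.1.col_strict hi ((hκ _ _).1 hc).1
            zeros' := fun hc => if_neg hc }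
        property := by
          intro i j hc
          change 1 ≤ (if (i, j) ∈ κ then U.1 i j else 0) ∧
            (if (i, j) ∈ κ then U.1 i j else 0) ≤ m
          rw [if_pos hc]
          exact ⟨(U.2 _ _ ((hκ _ _).1 hc).1).1, ((hκ _ _).1 hc).2⟩ }
    refine ⟨⟨⟨κ, hs⟩, T⟩, Subtype.ext ?_⟩
    ext i j
    by_cases hc : (i, j) ∈ μ
    · by_cases hk : (i, j) ∈ κ
      · exact (extend_of_mem hs T hk).trans (if_pos hk)
      · rw [extend_of_notMem hs T hk hc]
        have h1 := (U.2 _ _ hc).2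
        have h2 : ¬ U.1 i j ≤ m := fun h => hk ((hκ i j).2 ⟨hc, h⟩)
        omega
    · rw [SemistandardYoungTableau.zeros _ hc, U.1.zeros hc]

theorem finite_setOf_card_eq (n : ℕ) : {μ : YoungDiagram | μ.card = n}.Finite :=
  Set.finite_coe_iff.1 (shapeFinite n)

theorem finite_setOf_isStrip (μ : YoungDiagram) : {κ | IsStrip κ μ}.Finite := by
  refine Set.Finite.subset
    (Set.Finite.preimage (f := YoungDiagram.cells) ?_ μ.cells.powerset.finite_toSet) ?_
  · exact fun κ _ κ' _ h => YoungDiagram.ext h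
  · exact fun κ hκ => Finset.mem_coe.2 (Finset.mem_powerset.2 hκ.1)

/-- The partitions of `n`. -/
noncomputable def shapes (n : ℕ) : Finset YoungDiagram := (finite_setOf_card_eq n).toFinset

/-- The diagrams obtained from `μ` by removing a horizontal strip. -/
noncomputable def strips (μ : YoungDiagram) : Finset YoungDiagram :=
  (finite_setOf_isStrip μ).toFinset

@[simp]
theorem mem_shapes {n : ℕ} {μ : YoungDiagram} : μ ∈ shapes n ↔ μ.card = n := by
  simp [shapes]

@[simp]
theorem mem_strips {κ μ : YoungDiagram} : κ ∈ strips μ ↔ IsStrip κ μ := by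
  simp [strips]

theorem sum_ssyt_succ {M : Type*} [AddCommMonoid M] (μ : YoungDiagram) (m : ℕ)
    (F : SSYT μ (m + 1) → M) (G : ∀ κ : YoungDiagram, SSYT κ m → M)
    (hFG : ∀ κ (h : IsStrip κ μ) (T : SSYT κ m), F (extend h T) = G κ T) :
    ∑ T, F T = ∑ κ ∈ strips μ, ∑ T, G κ T := by
  have : Fintype {κ // IsStrip κ μ} := (finite_setOf_isStrip μ).fintype
  rw [← (extend_bijective μ m).sum_comp, Fintype.sum_sigma,
    Finset.sum_subtype (strips μ) (fun κ => mem_strips) fun κ => ∑ T, G κ T]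
  exact Finset.sum_congr rfl fun κ _ => Finset.sum_congr rfl fun T _ => hFG _ _ _

/-! ### Schur polynomials and multiplication by the sum of the variables -/

variable {R : Type*} [CommRing R]

/-- The Schur polynomial of `μ` evaluated at `x 0, …, x (m - 1)`. Fixing an infinite sequence `x`
allows inductions on the number `m` of variables inside a single ring. -/
noncomputable def schurEval (x : ℕ → R) (m : ℕ) (μ : YoungDiagram) : R :=
  ∑ T : SSYT μ m, ∏ i ∈ Finset.range m, x i ^ content T.1 (i + 1)

theorem content_extend_of_le {κ μ : YoungDiagram} (h : IsStrip κ μ) {m : ℕ} (T : SSYT κ m)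
    {k : ℕ} (hk : k ≤ m) : content (extend h T).1 k = content T.1 k := by
  unfold content
  congr 1
  ext ⟨i, j⟩
  simp only [Finset.mem_filter, YoungDiagram.mem_cells]
  constructor
  · rintro ⟨hc, he⟩
    have hc' : (i, j) ∈ κ := (mem_iff_extend_le h T hc).2 (he.trans_le hk)
    exact ⟨hc', (extend_of_mem h T hc').symm.trans he⟩
  · rintro ⟨hc, he⟩
    exact ⟨h.1 hc, (extend_of_mem h T hc).trans he⟩

theorem content_extend_succ {κ μ : YoungDiagram} (h : IsStrip κ μ) {m : ℕ} (T : SSYT κ m) :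
    content (extend h T).1 (m + 1) = μ.card - κ.card := by
  rw [content, YoungDiagram.card, YoungDiagram.card, ← Finset.card_sdiff_of_subset
    (YoungDiagram.cells_subset_iff.2 h.1)]
  congr 1
  ext ⟨i, j⟩
  simp only [Finset.mem_filter, Finset.mem_sdiff, YoungDiagram.mem_cells]
  refine and_congr_right fun hc => ?_
  rw [mem_iff_extend_le h T hc]
  have := ((extend h T).2 _ _ hc).2
  omega

/-- The branching rule: the cells with the largest entry form a horizontal strip. -/
theorem schurEval_succ (x : ℕ → R) (m : ℕ) (μ : YoungDiagram) :
    schurEval x (m + 1) μ =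
      ∑ κ ∈ strips μ, schurEval x m κ * x m ^ (μ.card - κ.card) := by
  unfold schurEval
  simp only [Finset.sum_mul]
  refine sum_ssyt_succ μ m _
    (fun κ T => (∏ i ∈ Finset.range m, x i ^ content T.1 (i + 1)) * x m ^ (μ.card - κ.card))
    fun κ h T => ?_
  rw [Finset.prod_range_succ, content_extend_succ]
  congr 1
  refine Finset.prod_congr rfl fun i hi => ?_
  rw [content_extend_of_le h T (Finset.mem_range.1 hi)]

theorem schurEval_zero_of_card_ne_zero (x : ℕ → R) {μ : YoungDiagram} (h : μ.card ≠ 0) :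
    schurEval x 0 μ = 0 := by
  obtain ⟨⟨i, j⟩, hc⟩ := Finset.card_ne_zero.1 h
  have : IsEmpty (SSYT μ 0) := ⟨fun T => by
    have := T.2 _ _ hc
    omega⟩
  exact Finset.sum_of_isEmpty _

theorem finite_setOf_covers (μ : YoungDiagram) : {ν | Covers μ ν}.Finite :=
  (finite_setOf_card_eq (μ.card + 1)).subset fun _ h => h.2

/-- The diagrams obtained from `μ` by adding a cell. -/
noncomputable def ups (μ : YoungDiagram) : Finset YoungDiagram :=
  (finite_setOf_covers μ).toFinset

@[simp]
theorem mem_ups {μ ν : YoungDiagram} : ν ∈ ups μ ↔ Covers μ ν := by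
  simp [ups]

theorem card_le_of_isStrip {κ μ : YoungDiagram} (h : IsStrip κ μ) : κ.card ≤ μ.card :=
  Finset.card_le_card h.1

open scoped Classical in
/-- Summed form of `ncard_covers_isStrip`. -/
theorem sum_ups_strips {M : Type*} [AddCommMonoid M] (μ : YoungDiagram) (F : YoungDiagram → M) :
    ∑ ν ∈ ups μ, ∑ ρ ∈ strips ν, F ρ =
      ∑ κ ∈ strips μ, ∑ ρ ∈ ups κ, F ρ + ∑ ρ ∈ strips μ, F ρ := by
  let W : Finset YoungDiagram := (Finset.range (μ.card + 2)).biUnion shapes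
  have hW : ∀ ρ, ρ ∈ W ↔ ρ.card ≤ μ.card + 1 := fun ρ => by
    simp only [W, Finset.mem_biUnion, Finset.mem_range, mem_shapes]
    exact ⟨fun ⟨a, h, h'⟩ => by omega, fun h => ⟨_, by omega, rfl⟩⟩
  have h1 : ∑ ν ∈ ups μ, ∑ ρ ∈ strips ν, F ρ =
      ∑ ρ ∈ W, ∑ ν ∈ (ups μ).filter (IsStrip ρ), F ρ := by
    refine Finset.sum_comm' fun ν ρ => ?_
    simp only [mem_ups, mem_strips, Finset.mem_filter, hW]
    refine ⟨fun h => ⟨h, ?_⟩, fun h => h.1⟩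
    exact h.1.2 ▸ card_le_of_isStrip h.2
  have h2 : ∑ κ ∈ strips μ, ∑ ρ ∈ ups κ, F ρ =
      ∑ ρ ∈ W, ∑ κ ∈ (strips μ).filter (fun κ => Covers κ ρ), F ρ := by
    refine Finset.sum_comm' fun κ ρ => ?_
    simp only [mem_ups, mem_strips, Finset.mem_filter, hW]
    refine ⟨fun h => ⟨h, ?_⟩, fun h => h.1⟩
    have := card_le_of_isStrip h.1
    have := h.2.2
    omega
  have h3 : ∑ ρ ∈ strips μ, F ρ = ∑ ρ ∈ W, if IsStrip ρ μ then F ρ else 0 := by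
    rw [← Finset.sum_filter]
    refine Finset.sum_congr (Finset.ext fun ρ => ?_) fun _ _ => rfl
    simp only [mem_strips, Finset.mem_filter, hW]
    exact ⟨fun h => ⟨(card_le_of_isStrip h).trans (Nat.le_succ _), h⟩, fun h => h.2⟩
  rw [h1, h2, h3, ← Finset.sum_add_distrib]
  refine Finset.sum_congr rfl fun ρ _ => ?_
  have hcard := ncard_covers_isStrip μ ρ
  have e1 : {ν | Covers μ ν ∧ IsStrip ρ ν} = ((ups μ).filter (IsStrip ρ) : Set YoungDiagram) := by
    ext; simp
  have e2 : {κ | Covers κ ρ ∧ IsStrip κ μ} =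
      ((strips μ).filter (fun κ => Covers κ ρ) : Set YoungDiagram) := by
    ext; simp [and_comm]
  rw [e1, e2, Set.ncard_coe_finset, Set.ncard_coe_finset] at hcard
  rw [Finset.sum_const, Finset.sum_const, hcard, add_smul]
  split_ifs <;> simp

/-- Pieri's rule for one cell, by induction on the number of variables. -/
theorem sum_mul_schurEval (x : ℕ → R) (m : ℕ) (μ : YoungDiagram) :
    (∑ i ∈ Finset.range m, x i) * schurEval x m μ = ∑ ν ∈ ups μ, schurEval x m ν := by
  induction m generalizing μ with
  | zero =>
    rw [Finset.sum_range_zero, zero_mul, Finset.sum_eq_zero]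
    intro ν hν
    refine schurEval_zero_of_card_ne_zero x ?_
    have := (mem_ups.1 hν).2
    omega
  | succ m ih =>
    have hup : ∑ ν ∈ ups μ, schurEval x (m + 1) ν =
        ∑ ν ∈ ups μ, ∑ ρ ∈ strips ν, schurEval x m ρ * x m ^ (μ.card + 1 - ρ.card) := by
      refine Finset.sum_congr rfl fun ν hν => ?_
      rw [schurEval_succ, (mem_ups.1 hν).2]
    rw [hup, sum_ups_strips, schurEval_succ, Finset.sum_range_succ, add_mul, Finset.mul_sum,
      Finset.mul_sum]
    congr 1
    · refine Finset.sum_congr rfl fun κ _ => ?_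
      rw [← mul_assoc, ih, Finset.sum_mul]
      refine Finset.sum_congr rfl fun ρ hρ => ?_
      rw [(mem_ups.1 hρ).2, Nat.add_sub_add_right]
    · refine Finset.sum_congr rfl fun κ hκ => ?_
      rw [Nat.sub_add_comm (card_le_of_isStrip (mem_strips.1 hκ)), pow_succ]
      ring

/-! ### Single columns -/

/-- The Young diagram with one column, of `k` cells. -/
def column (k : ℕ) : YoungDiagram where
  cells := Finset.range k ×ˢ {0}
  isLowerSet := by
    rintro ⟨a, b⟩ ⟨a', b'⟩ hle hc
    have hle' := Prod.mk_le_mk.1 hle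
    simp only [Finset.coe_product, Set.mem_prod, Finset.mem_coe, Finset.mem_range,
      Finset.mem_singleton] at hc ⊢
    omega

theorem mem_column {k i j : ℕ} : (i, j) ∈ column k ↔ i < k ∧ j = 0 := by
  change (i, j) ∈ Finset.range k ×ˢ {0} ↔ _
  rw [Finset.mem_product, Finset.mem_range, Finset.mem_singleton]

theorem card_column (k : ℕ) : (column k).card = k := by
  change (Finset.range k ×ˢ {0}).card = k
  simp

open scoped Classical in
theorem strips_column_succ (k : ℕ) : strips (column (k + 1)) = {column (k + 1), column k} := by
  ext κ
  rw [mem_strips, Finset.mem_insert, Finset.mem_singleton]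
  constructor
  · rintro ⟨h1, h2⟩
    have h3 : ∀ i < k, (i, 0) ∈ κ := fun i hi => h2 i 0 (mem_column.2 ⟨by omega, rfl⟩)
    by_cases hk : (k, 0) ∈ κ
    · left
      refine le_antisymm h1 ?_
      rintro ⟨i, j⟩ hc
      obtain ⟨hi, rfl⟩ := mem_column.1 hc
      exact κ.up_left_mem (Nat.lt_succ_iff.1 hi) le_rfl hk
    · right
      refine le_antisymm ?_ ?_
      · rintro ⟨i, j⟩ hc
        obtain ⟨hi, rfl⟩ := mem_column.1 (h1 hc)
        have : i ≠ k := by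
          rintro rfl
          exact hk hc
        exact mem_column.2 ⟨by omega, rfl⟩
      · rintro ⟨i, j⟩ hc
        obtain ⟨hi, rfl⟩ := mem_column.1 hc
        exact h3 i hi
  · rintro (rfl | rfl)
    · exact ⟨le_rfl, fun i j h => (column (k + 1)).up_left_mem (Nat.le_succ i) le_rfl h⟩
    · refine ⟨?_, fun i j h => ?_⟩
      · rintro ⟨i, j⟩ hc
        obtain ⟨hi, rfl⟩ := mem_column.1 hc
        exact mem_column.2 ⟨by omega, rfl⟩
      · obtain ⟨hi, rfl⟩ := mem_column.1 h
        exact mem_column.2 ⟨by omega, rfl⟩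

theorem schurEval_column_zero (x : ℕ → R) (m : ℕ) : schurEval x m (column 0) = 1 := by
  have hc : ∀ i j, (i, j) ∉ column 0 := fun i j h => by
    have := mem_column.1 h
    omega
  let T₀ : SSYT (column 0) m :=
    ⟨SemistandardYoungTableau.highestWeight _, fun i j h => absurd h (hc i j)⟩
  have : Unique (SSYT (column 0) m) :=
    { default := T₀
      uniq := fun T => Subtype.ext <| SemistandardYoungTableau.ext fun i j => by
        rw [T.1.zeros (hc i j), SemistandardYoungTableau.zeros _ (hc i j)] }
  rw [schurEval, Fintype.sum_unique]
  refine Finset.prod_eq_one fun i _ => ?_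
  have h0 : (column 0).cells = ∅ := Finset.card_eq_zero.1 (card_column 0)
  rw [content, h0, Finset.filter_empty, Finset.card_empty, pow_zero]

open scoped Classical in
theorem schurEval_column_succ (x : ℕ → R) (m k : ℕ) :
    schurEval x (m + 1) (column (k + 1)) =
      schurEval x m (column (k + 1)) + schurEval x m (column k) * x m := by
  have hne : column (k + 1) ≠ column k := fun h => by
    have := congrArg YoungDiagram.card h
    rw [card_column, card_column] at this
    omega
  rw [schurEval_succ, strips_column_succ, Finset.sum_pair hne, card_column, card_column,
    Nat.sub_self, Nat.add_sub_cancel_left, pow_zero, pow_one, mul_one]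

/-- The expansion of `∏ (t - x i)` in elementary symmetric polynomials, which appear here as the
Schur polynomials of single columns. The factor `t ^ r` lets the induction on `m` proceed, since
`t - x m` lowers the exponent of one of its two terms. -/
theorem sum_schurEval_column (x : ℕ → R) (t : R) (m r : ℕ) :
    (∏ i ∈ Finset.range m, (t - x i)) * t ^ r =
      ∑ k ∈ Finset.range (m + r + 1),
        (-1) ^ k * (schurEval x m (column k) * t ^ (m + r - k)) := by
  induction m generalizing r with
  | zero =>
    rw [Finset.sum_range_succ', Finset.sum_eq_zero]
    · simp [schurEval_column_zero]
    · intro k _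
      rw [schurEval_zero_of_card_ne_zero, zero_mul, mul_zero]
      rw [card_column]
      omega
  | succ m ih =>
    have h1 := ih (r + 1)
    have h2 := ih r
    have hlhs : (∏ i ∈ Finset.range (m + 1), (t - x i)) * t ^ r =
        (∏ i ∈ Finset.range m, (t - x i)) * t ^ (r + 1) -
          ((∏ i ∈ Finset.range m, (t - x i)) * t ^ r) * x m := by
      rw [Finset.prod_range_succ]
      ring
    rw [hlhs, h1, h2, Finset.sum_range_succ', Finset.sum_range_succ' _ (m + 1 + r),
      schurEval_column_zero, schurEval_column_zero, add_right_comm m 1 r, ← add_assoc,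
      add_sub_right_comm]
    congr 1
    rw [Finset.sum_mul, ← Finset.sum_sub_distrib]
    refine Finset.sum_congr rfl fun k _ => ?_
    rw [schurEval_column_succ, Nat.add_sub_add_right]
    ring

/-! ### Standard tableaux that begin with a column -/

/-- The entries of `T` are distinct, and those up to `k` all lie in the first column. -/
def IsColumnStart {μ : YoungDiagram} {n : ℕ} (k : ℕ) (T : SSYT μ n) : Prop :=
  Set.InjOn (fun c : ℕ × ℕ => T.1 c.1 c.2) (μ.cells : Set (ℕ × ℕ)) ∧
    ∀ i j, (i, j) ∈ μ → T.1 i j ≤ k → j = 0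

open scoped Classical in
/-- The number of fillings of `μ` by distinct entries from `{1, …, n}`, increasing along rows and
columns, in which the entries up to `k` all lie in the first column. -/
noncomputable def columnStartCount (k n : ℕ) (μ : YoungDiagram) : ℕ :=
  ∑ T : SSYT μ n, if IsColumnStart k T then 1 else 0

theorem card_le_of_injOn {μ : YoungDiagram} {n : ℕ} (T : SSYT μ n)
    (h : Set.InjOn (fun c : ℕ × ℕ => T.1 c.1 c.2) (μ.cells : Set (ℕ × ℕ))) : μ.card ≤ n := by
  have := Finset.card_le_card_of_injOn (t := Finset.Icc 1 n) _
    (fun c hc => Finset.mem_coe.2 (Finset.mem_Icc.2 (T.2 c.1 c.2 hc))) h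
  simpa using this

theorem isColumnStart_extend {κ μ : YoungDiagram} (h : IsStrip κ μ) {k n : ℕ} (hk : k ≤ n)
    (hμ : μ.card = n + 1) (T : SSYT κ n) :
    IsColumnStart k (extend h T) ↔ Covers κ μ ∧ IsColumnStart k T := by
  have hsub : κ.cells ⊆ μ.cells := h.1
  have hsd := Finset.card_sdiff_of_subset hsub
  have hle : κ.card ≤ μ.card := card_le_of_isStrip h
  constructor
  · rintro ⟨hinj, hcol⟩
    have hinj' : Set.InjOn (fun c : ℕ × ℕ => T.1 c.1 c.2) (κ.cells : Set (ℕ × ℕ)) := by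
      rintro ⟨i, j⟩ hc ⟨i', j'⟩ hc' heq
      refine hinj (hsub hc) (hsub hc') ?_
      simp only
      rw [extend_of_mem h T hc, extend_of_mem h T hc']
      exact heq
    refine ⟨⟨h.1, ?_⟩, hinj', fun i j hc hle => ?_⟩
    · have h1 := card_le_of_injOn T hinj'
      have h2 : (μ.cells \ κ.cells).card ≤ 1 := by
        refine Finset.card_le_one.2 ?_
        rintro ⟨i, j⟩ hc ⟨i', j'⟩ hc'
        obtain ⟨m1, n1⟩ := Finset.mem_sdiff.1 hc
        obtain ⟨m2, n2⟩ := Finset.mem_sdiff.1 hc'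
        refine hinj m1 m2 ?_
        simp only
        rw [extend_of_notMem h T n1 m1, extend_of_notMem h T n2 m2]
      change μ.cells.card = κ.cells.card + 1
      change κ.cells.card ≤ n at h1
      change μ.cells.card = n + 1 at hμ
      omega
    · exact hcol i j (h.1 hc) ((extend_of_mem h T hc).trans_le hle)
  · rintro ⟨⟨-, hcard⟩, hinj, hcol⟩
    have h2 : (μ.cells \ κ.cells).card ≤ 1 := by
      rw [hsd]
      exact (Nat.sub_eq_of_eq_add' hcard).le
    refine ⟨?_, fun i j hc hle => ?_⟩
    · rintro ⟨i, j⟩ hc ⟨i', j'⟩ hc' heq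
      simp only at heq
      by_cases m1 : (i, j) ∈ κ
      · have m2 : (i', j') ∈ κ := by
          rw [mem_iff_extend_le h T hc', ← heq]
          exact (mem_iff_extend_le h T hc).1 m1
        rw [extend_of_mem h T m1, extend_of_mem h T m2] at heq
        exact hinj m1 m2 heq
      · have m2 : (i', j') ∉ κ := by
          rw [mem_iff_extend_le h T hc', ← heq]
          rwa [mem_iff_extend_le h T hc] at m1
        exact Finset.card_le_one.1 h2 _ (Finset.mem_sdiff.2 ⟨hc, m1⟩) _
          (Finset.mem_sdiff.2 ⟨hc', m2⟩)
    · have m1 := (mem_iff_extend_le h T hc).2 (hle.trans hk)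
      exact hcol i j m1 ((extend_of_mem h T m1).symm.trans_le hle)

theorem Covers.isStrip {κ μ : YoungDiagram} (h : Covers κ μ) : IsStrip κ μ := by
  refine ⟨h.1, fun i j hc => ?_⟩
  have hsub : κ.cells ⊆ μ.cells := h.1
  have h2 : (μ.cells \ κ.cells).card ≤ 1 := by
    rw [Finset.card_sdiff_of_subset hsub]
    exact (Nat.sub_eq_of_eq_add' h.2).le
  by_contra hn
  have hn' : (i + 1, j) ∉ κ := fun h' => hn (κ.up_left_mem (Nat.le_succ i) le_rfl h')
  have := Finset.card_le_one.1 h2 _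
    (Finset.mem_sdiff.2 ⟨μ.up_left_mem (Nat.le_succ i) le_rfl hc, hn⟩) _
    (Finset.mem_sdiff.2 ⟨hc, hn'⟩)
  simp at this

open scoped Classical in
/-- Removing the cell of the largest entry. -/
theorem columnStartCount_succ {k n : ℕ} (hk : k ≤ n) {μ : YoungDiagram} (hμ : μ.card = n + 1) :
    columnStartCount k (n + 1) μ =
      ∑ κ ∈ (shapes n).filter (fun κ => Covers κ μ), columnStartCount k n κ := by
  have h1 : columnStartCount k (n + 1) μ = ∑ κ ∈ strips μ, ∑ T : SSYT κ n,
      if Covers κ μ ∧ IsColumnStart k T then 1 else 0 := by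
    refine sum_ssyt_succ μ n _
      (fun κ T => if Covers κ μ ∧ IsColumnStart k T then 1 else 0) fun κ h T => ?_
    exact if_congr (isColumnStart_extend h hk hμ T) rfl rfl
  have h2 : (shapes n).filter (fun κ => Covers κ μ) =
      (strips μ).filter (fun κ => Covers κ μ) := by
    ext κ
    simp only [Finset.mem_filter, mem_shapes, mem_strips]
    refine and_congr_left fun h => iff_of_true ?_ h.isStrip
    exact Nat.succ_injective (h.2.symm.trans hμ)
  rw [h1, h2, Finset.sum_filter]
  refine Finset.sum_congr rfl fun κ _ => ?_
  split_ifs with h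
  · simp only [h, true_and]
    rfl
  · simp [h]

open scoped Classical in
/-- A column has exactly one standard tableau. -/
theorem columnStartCount_self {k : ℕ} {μ : YoungDiagram} (hμ : μ.card = k) :
    columnStartCount k k μ = if μ = column k then 1 else 0 := by
  split_ifs with h
  · subst h
    let T₀ : SSYT (column k) k :=
      { val :=
          { entry := fun i j => if (i, j) ∈ column k then i + 1 else 0
            row_weak' := by
              intro i j1 j2 hj hc
              have := (mem_column.1 hc).2
              omega
            col_strict' := by
              intro i1 i2 j hi hc
              rw [if_pos hc, if_pos ((column k).up_left_mem hi.le le_rfl hc)]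
              omega
            zeros' := fun hc => if_neg hc }
        property := by
          intro i j hc
          change 1 ≤ (if (i, j) ∈ column k then i + 1 else 0) ∧
            (if (i, j) ∈ column k then i + 1 else 0) ≤ k
          rw [if_pos hc]
          have := (mem_column.1 hc).1
          omega }
    have hT₀ : ∀ i, i < k → T₀.1 i 0 = i + 1 := fun i hi => if_pos (mem_column.2 ⟨hi, rfl⟩)
    have huniq : ∀ T : SSYT (column k) k, T = T₀ := by
      intro T
      have hlow : ∀ i, i < k → i + 1 ≤ T.1 i 0 := by
        intro i
        induction i with
        | zero => exact fun hi => (T.2 0 0 (mem_column.2 ⟨hi, rfl⟩)).1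
        | succ i ih =>
          intro hi
          have h1 := ih (by omega)
          have h2 := T.1.col_strict (Nat.lt_add_one i) (mem_column.2 ⟨hi, rfl⟩)
          omega
      have hupp : ∀ d i, i + d + 1 = k → T.1 i 0 ≤ i + 1 := by
        intro d
        induction d with
        | zero =>
          intro i hi
          have := (T.2 i 0 (mem_column.2 ⟨by omega, rfl⟩)).2
          omega
        | succ d ih =>
          intro i hi
          have h1 := ih (i + 1) (by omega)
          have hc : (i + 1, 0) ∈ column k := mem_column.2 ⟨by omega, rfl⟩
          have h2 := T.1.col_strict (Nat.lt_add_one i) hc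
          omega
      apply Subtype.ext
      ext i j
      by_cases hc : (i, j) ∈ column k
      · obtain ⟨hi, rfl⟩ := mem_column.1 hc
        rw [hT₀ i hi]
        exact le_antisymm (hupp (k - i - 1) i (by omega)) (hlow i hi)
      · rw [T.1.zeros hc, SemistandardYoungTableau.zeros _ hc]
    have hstart : IsColumnStart k T₀ := by
      refine ⟨?_, fun i j hc _ => (mem_column.1 hc).2⟩
      rintro ⟨i, j⟩ hc ⟨i', j'⟩ hc' heq
      obtain ⟨hi, rfl⟩ := mem_column.1 hc
      obtain ⟨hi', rfl⟩ := mem_column.1 hc'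
      simp only at heq
      rw [hT₀ i hi, hT₀ i' hi'] at heq
      rw [Nat.succ_injective heq]
    rw [columnStartCount, Fintype.sum_eq_single T₀ fun T hT => absurd (huniq T) hT, if_pos hstart]
  · refine Finset.sum_eq_zero fun T _ => if_neg fun hT => h ?_
    have hsub : μ.cells ⊆ (column k).cells := by
      rintro ⟨i, j⟩ hc
      exact mem_column.2 ⟨hμ ▸ (lt_card_of_mem hc).1, hT.2 i j hc (T.2 i j hc).2⟩
    exact YoungDiagram.ext (Finset.eq_of_subset_of_card_le hsub
      (((card_column k).trans hμ.symm).le))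

open scoped Classical in
/-- The Schur expansion of an elementary symmetric polynomial times a power of the sum of the
variables, by iterating Pieri's rule. -/
theorem schurEval_column_mul_pow {R : Type*} [CommRing R] (x : ℕ → R) (m k r : ℕ) :
    schurEval x m (column k) * (∑ i ∈ Finset.range m, x i) ^ r =
      ∑ μ ∈ shapes (k + r), columnStartCount k (k + r) μ • schurEval x m μ := by
  induction r with
  | zero =>
    have h1 : ∑ μ ∈ shapes (k + 0), columnStartCount k (k + 0) μ • schurEval x m μ =
        ∑ μ ∈ shapes k, if μ = column k then schurEval x m μ else 0 := by
      refine Finset.sum_congr rfl fun μ hμ => ?_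
      rw [add_zero, columnStartCount_self (mem_shapes.1 hμ), ite_smul, one_smul, zero_smul]
    rw [h1, Finset.sum_ite_eq', if_pos (mem_shapes.2 (card_column k)), pow_zero, mul_one]
  | succ r ih =>
    rw [pow_succ, ← mul_assoc, ih, mul_comm, Finset.mul_sum]
    simp only [mul_smul_comm, sum_mul_schurEval, Finset.smul_sum]
    rw [Finset.sum_comm' (t' := shapes (k + (r + 1)))
      (s' := fun ν => (shapes (k + r)).filter fun μ => Covers μ ν)]
    · refine Finset.sum_congr rfl fun ν hν => ?_
      rw [← Finset.sum_smul, ← add_assoc,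
        columnStartCount_succ (Nat.le_add_right k r) (mem_shapes.1 hν)]
    · intro μ ν
      simp only [mem_shapes, mem_ups, Finset.mem_filter]
      refine ⟨fun h => ⟨h, ?_⟩, fun h => h.1⟩
      rw [h.2.2, h.1, add_assoc]

/-! ### The smallest ascent -/

theorem exists_entry_eq {μ : YoungDiagram} (T : SYT μ) {k : ℕ} (h1 : 1 ≤ k) (hk : k ≤ μ.card) :
    ∃ i j, (i, j) ∈ μ ∧ T.1.1 i j = k := by
  have himg : μ.cells.image (fun c : ℕ × ℕ => T.1.1 c.1 c.2) = Finset.Icc 1 μ.card := by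
    refine Finset.eq_of_subset_of_card_le ?_ ?_
    · intro y hy
      obtain ⟨c, hc, rfl⟩ := Finset.mem_image.1 hy
      exact Finset.mem_Icc.2 (T.1.2 c.1 c.2 hc)
    · rw [Finset.card_image_of_injOn T.2, Nat.card_Icc, Nat.add_sub_cancel]
  have hmem : k ∈ μ.cells.image (fun c : ℕ × ℕ => T.1.1 c.1 c.2) :=
    himg ▸ Finset.mem_Icc.2 ⟨h1, hk⟩
  obtain ⟨c, hc, he⟩ := Finset.mem_image.1 hmem
  exact ⟨c.1, c.2, hc, he⟩

theorem cell_eq_of_entry_eq {μ : YoungDiagram} (T : SYT μ) {i j i' j' : ℕ} (hc : (i, j) ∈ μ)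
    (hc' : (i', j') ∈ μ) (h : T.1.1 i j = T.1.1 i' j') : i = i' ∧ j = j' :=
  Prod.mk.inj (T.2 hc hc' h)

theorem isAscent_card {μ : YoungDiagram} (T : SYT μ) (hμ : 1 ≤ μ.card) : IsAscent T μ.card := by
  refine ⟨exists_entry_eq T hμ le_rfl, ?_⟩
  rintro ⟨i, j, i', j', -, hc', -, he, -⟩
  have := (T.1.2 i' j' hc').2
  omega

/-- Below the smallest ascent every entry lies in a lower row than the next one. -/
theorem row_lt_of_entry_lt {μ : YoungDiagram} (T : SYT μ) {a : ℕ}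
    (ha : ∀ k, IsAscent T k → a ≤ k) (q : ℕ) (hq : q ≤ a) {i j i' j' : ℕ} (hc : (i, j) ∈ μ)
    (hc' : (i', j') ∈ μ) (hlt : T.1.1 i j < q) (he : T.1.1 i' j' = q) : i < i' := by
  induction q generalizing i' j' with
  | zero => omega
  | succ q ih =>
    have hpos := (T.1.2 i j hc).1
    have hup := (T.1.2 i' j' hc').2
    have hdesc : IsDescent T q := by
      by_contra hnot
      have := ha q ⟨exists_entry_eq T (by omega) (by omega), hnot⟩
      omega
    obtain ⟨b, c, b', c', hb, hb', e1, e2, hbb⟩ := hdesc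
    have h1 := (cell_eq_of_entry_eq T hc' hb' (he.trans e2.symm)).1
    have h2 : i ≤ b := by
      rcases (Nat.lt_succ_iff.1 hlt).lt_or_eq with h | h
      · exact (ih (by omega) hb h e1).le
      · exact (cell_eq_of_entry_eq T hc hb (h.trans e1.symm)).1.le
    omega

/-- The entries up to `k` lie in the first column precisely when the smallest ascent is at
least `k`. -/
theorem isColumnStart_iff_le {μ : YoungDiagram} (T : SYT μ) {a k : ℕ}
    (ha : IsLeast {k | IsAscent T k} a) (hk : k ≤ μ.card) : IsColumnStart k T.1 ↔ k ≤ a := by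
  constructor
  · rintro ⟨-, hcol⟩
    by_contra! hlt
    obtain ⟨⟨⟨i, j, hc, he⟩, hnot⟩, -⟩ := ha
    obtain ⟨i', j', hc', he'⟩ := exists_entry_eq T (k := a + 1) (by omega) (by omega)
    obtain rfl := hcol i j hc (by omega)
    obtain rfl := hcol i' j' hc' (by omega)
    have hle : i' ≤ i := by
      by_contra! h
      exact hnot ⟨i, 0, i', 0, hc, hc', he, he', h⟩
    have := T.1.1.col_weak hle hc
    omega
  · refine fun hka => ⟨T.2, fun i j hc hle => ?_⟩
    by_contra hj
    obtain ⟨j, rfl⟩ := Nat.exists_eq_succ_of_ne_zero hj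
    have hc' : (i, j) ∈ μ := μ.up_left_mem le_rfl (Nat.le_succ j) hc
    have h1 := T.1.1.row_weak (Nat.lt_add_one j) hc
    have h2 : T.1.1 i j ≠ T.1.1 i (j + 1) := fun h => by
      have := (cell_eq_of_entry_eq T hc' hc h).2
      omega
    exact lt_irrefl _ (row_lt_of_entry_lt T (fun k hk => ha.2 hk) _ (hle.trans hka) hc' hc
      (lt_of_le_of_ne h1 h2) rfl)

open scoped Classical in
/-- A tableau with smallest ascent `a` is counted for each `k ≤ a`, so that its contributions with
alternating signs add up to `1` if `a` is even and to `0` if `a` is odd. -/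
theorem sum_columnStartCount {μ : YoungDiagram} (hμ : 1 ≤ μ.card) :
    ∑ k ∈ Finset.range (μ.card + 1), (-1) ^ k * (columnStartCount k μ.card μ : ℤ) =
      evenAscentCount μ := by
  have hsyt : ∀ k, (columnStartCount k μ.card μ : ℤ) =
      ∑ T : SYT μ, if IsColumnStart k T.1 then 1 else 0 := by
    intro k
    rw [columnStartCount, Nat.cast_sum,
      ← Finset.sum_subtype (Finset.univ.filter fun T : SSYT μ μ.card =>
        Set.InjOn (fun c : ℕ × ℕ => T.1 c.1 c.2) (μ.cells : Set (ℕ × ℕ))) (by simp)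
      fun T => if IsColumnStart k T then (1 : ℤ) else 0, Finset.sum_filter]
    refine Finset.sum_congr rfl fun T _ => ?_
    by_cases h : IsColumnStart k T
    · simp [h, h.1]
    · simp [h]
  simp only [hsyt, Finset.mul_sum]
  rw [Finset.sum_comm, evenAscentCount, Nat.card_eq_fintype_card, Fintype.card_subtype,
    Finset.card_filter, Nat.cast_sum]
  refine Finset.sum_congr rfl fun T _ => ?_
  obtain ⟨a, ha⟩ : ∃ a, IsLeast {k | IsAscent T k} a :=
    ⟨_, Nat.sInf_mem ⟨_, isAscent_card T hμ⟩, fun _ h => Nat.sInf_le h⟩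
  have hac : a ≤ μ.card := ha.2 (isAscent_card T hμ)
  have heven : (∃ k, IsLeast {k | IsAscent T k} k ∧ Even k) ↔ Even a :=
    ⟨fun ⟨k, hk, he⟩ => ha.unique hk ▸ he, fun h => ⟨a, ha, h⟩⟩
  have hsum : ∑ k ∈ Finset.range (μ.card + 1),
      (-1 : ℤ) ^ k * (if IsColumnStart k T.1 then 1 else 0) =
      ∑ k ∈ Finset.range (a + 1), (-1) ^ k := by
    have hsub : Finset.range (a + 1) ⊆ Finset.range (μ.card + 1) :=
      Finset.range_subset_range.2 (by omega)
    rw [← Finset.sum_subset hsub]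
    · refine Finset.sum_congr rfl fun k hk => ?_
      have hka := Finset.mem_range.1 hk
      rw [if_pos ((isColumnStart_iff_le T ha (by omega)).2 (by omega)), mul_one]
    · intro k hk hka
      rw [Finset.mem_range] at hk hka
      rw [if_neg fun h => hka (Nat.lt_succ_of_le ((isColumnStart_iff_le T ha (by omega)).1 h)),
        mul_zero]
  rw [hsum, neg_one_geom_sum]
  simp only [heven, Nat.even_add_one]
  split_ifs <;> simp_all

/-! ### The Boolean product polynomial -/

/-- The sum over all variables but one is the full sum minus that variable. -/
theorem booleanProduct_pred {n : ℕ} (hn : 1 ≤ n) :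
    booleanProduct n (n - 1) =
      ∏ i : Fin n, (∑ j : Fin n, MvPolynomial.X j - MvPolynomial.X i) := by
  symm
  refine Finset.prod_bij (fun i _ => Finset.univ.erase i) ?_ ?_ ?_ ?_
  · intro i _
    rw [Finset.mem_powersetCard_univ, Finset.card_erase_of_mem (Finset.mem_univ i),
      Finset.card_univ, Fintype.card_fin]
  · intro i _ j _ h
    by_contra hne
    have : j ∈ Finset.univ.erase i := Finset.mem_erase.2 ⟨Ne.symm hne, Finset.mem_univ j⟩
    rw [h] at this
    exact Finset.notMem_erase j _ this
  · intro S hS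
    have hS' := Finset.mem_powersetCard_univ.1 hS
    have hc : Sᶜ.card = 1 := by
      rw [Finset.card_compl, hS', Fintype.card_fin]
      omega
    obtain ⟨i, hi⟩ := Finset.card_eq_one.1 hc
    refine ⟨i, Finset.mem_univ i, ?_⟩
    rw [← compl_compl S, hi]
    ext j
    simp
  · intro i _
    rw [sub_eq_iff_eq_add, Finset.sum_erase_add _ _ (Finset.mem_univ i)]

/-- The variables of `MvPolynomial (Fin n) ℂ`, continued by zero. -/
noncomputable def variableSeq (n i : ℕ) : MvPolynomial (Fin n) ℂ :=
  if h : i < n then MvPolynomial.X ⟨i, h⟩ else 0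

@[simp]
theorem variableSeq_coe {n : ℕ} (i : Fin n) : variableSeq n i = MvPolynomial.X i :=
  dif_pos i.2

theorem schur_eq_schurEval (μ : YoungDiagram) (n : ℕ) :
    schur μ n = schurEval (variableSeq n) n μ := by
  refine Finset.sum_congr rfl fun T _ => ?_
  rw [Finset.prod_range]
  simp

end BooleanProduct

theorem mainTheorem2 (n : ℕ) (hn : 2 ≤ n) :
    BooleanProduct.booleanProduct n (n - 1) =
      ∑ μ : BooleanProduct.Shape n,
        BooleanProduct.evenAscentCount μ.1 • BooleanProduct.schur μ.1 n := by
  open BooleanProduct in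
  set x := variableSeq n with hx
  set t := ∑ i ∈ Finset.range n, x i with ht
  have hB : booleanProduct n (n - 1) = ∏ i ∈ Finset.range n, (t - x i) := by
    rw [booleanProduct_pred (by omega), Finset.prod_range, ht, Finset.sum_range]
    simp [hx]
  have hcol : ∏ i ∈ Finset.range n, (t - x i) = ∑ k ∈ Finset.range (n + 1),
      (-1) ^ k * (schurEval x n (column k) * t ^ (n - k)) := by
    simpa using sum_schurEval_column x t n 0
  have hpieri : ∀ k ∈ Finset.range (n + 1), schurEval x n (column k) * t ^ (n - k) =
      ∑ μ ∈ shapes n, columnStartCount k n μ • schurEval x n μ := by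
    intro k hk
    have hkn : k + (n - k) = n := Nat.add_sub_of_le (Nat.lt_succ_iff.1 (Finset.mem_range.1 hk))
    have := schurEval_column_mul_pow x n k (n - k)
    rwa [hkn] at this
  have hshape : ∑ μ : Shape n, evenAscentCount μ.1 • schur μ.1 n =
      ∑ μ ∈ shapes n, evenAscentCount μ • schurEval x n μ := by
    simp only [schur_eq_schurEval]
    exact (Finset.sum_subtype (shapes n) (fun μ => mem_shapes)
      fun μ => evenAscentCount μ • schurEval x n μ).symm
  rw [hB, hcol, hshape, Finset.sum_congr rfl fun k hk => congrArg _ (hpieri k hk)]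
  simp only [Finset.mul_sum]
  rw [Finset.sum_comm]
  refine Finset.sum_congr rfl fun μ hμ => ?_
  obtain rfl := mem_shapes.1 hμ
  have hcount := congrArg (Int.cast (R := MvPolynomial (Fin μ.card) ℂ))
    (sum_columnStartCount (μ := μ) (by omega))
  push_cast at hcount
  rw [nsmul_eq_mul, ← hcount, Finset.sum_mul]
  exact Finset.sum_congr rfl fun k _ => by rw [nsmul_eq_mul, mul_assoc]
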